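/- Conventions. All ideals of C*-algebras are closed and two-sided; $\mathbb K$ is the algebra of compact operators on $\ell^2(\mathbb N)$ and $\mathcal O_\infty$ is the Cuntz algebra generated by an infinite sequence of isometries with pairwise orthogonal ranges. A C*-algebra $D$ is stable if $D\cong D\otimes\mathbb K$, and $B$ is $\mathcal O_\infty$-stable if $B\cong B\otimes\mathcal O_\infty$. An extension $0\to J\to A\to B\to 0$ of C*-algebras is purely large if for every $a\in A\setminus J$ the hereditary subalgebra $\overline{aJa^*}$ contains a stable, $\sigma$-unital C*-subalgebra $D$ that is full in $J$ (i.e. $D$ generates $J$ as an ideal). For a free ultrafilter $\omega$ on $\mathbb N$ and a sequence $(A_i)_{i\in\mathbb N}$ of C*-algebras, the ultraproduct $\prod_{i\to\omega}A_i$ is the quotient of the C*-algebra of norm-bounded sequences $(a_i)_i$, $a_i\in A_i$, by the ideal of those with $\lim_{i\to\omega}\|a_i\|=0$. Proposition. Let $\omega$ be a free ultrafilter on $\mathbb N$ and let $(0\to J_i\to A_i\xrightarrow{\pi_i}B_i\to 0)_{i\in\mathbb N}$ be a sequence of purely large extensions of C*-algebras in which every $B_i$ is $\mathcal O_\infty$-stable.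 Let $$\pi_\omega:\prod_{i\to\omega}A_i\to\prod_{i\to\omega}B_i$$ be the $*$-homomorphism induced by $(\pi_i)_i$, and let $x,y\in\prod_{i\to\omega}A_i$ with $\pi_\omega(y)\neq 0$. If $\pi_\omega(x)$ is in the ideal of $\prod_{i\to\omega}B_i$ generated by $\pi_\omega(y)$, then $x$ is in the ideal of $\prod_{i\to\omega}A_i$ generated by $y$. -/

import Mathlib

open Filter Topology
open scoped ENNReal TensorProduct

noncomputable section

namespace PurelyLarge

/-! ### Closed two-sided ideals -/

/-- The ideal generated by `S`: the smallest closed two-sided ideal of `A` containing `S`.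
(A closed two-sided ring ideal of a C⋆-algebra is automatically a complex subspace.) -/
def closedIdeal {A : Type*} [NonUnitalCStarAlgebra A] (S : Set A) : TwoSidedIdeal A :=
  sInf {I : TwoSidedIdeal A | IsClosed (I : Set A) ∧ S ⊆ (I : Set A)}

/-! ### The compact operators and the Cuntz algebra `O_∞` -/

section Compact

variable {H : Type*} [NormedAddCommGroup H] [InnerProductSpace ℂ H] [CompleteSpace H]

/-- The adjoint of a compact operator on a Hilbert space is compact. -/
theorem isCompactOperator_star {T : H →L[ℂ] H} (hT : IsCompactOperator T) :
    IsCompactOperator (star T : H →L[ℂ] H) := by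
  have hTT : IsCompactOperator (T * star T : H →L[ℂ] H) := hT.comp_clm (star T)
  have key : ∀ z : H, ‖(star T) z‖ ^ 2 ≤ ‖(T * star T) z‖ * ‖z‖ := by
    intro z
    have h : inner ℂ ((T * star T) z) z = ((‖(star T) z‖ ^ 2 : ℝ) : ℂ) := by
      rw [mul_apply_eq_comp, ContinuousLinearMap.star_eq_adjoint,
        ← ContinuousLinearMap.adjoint_inner_right, inner_self_eq_norm_sq_to_K]
      norm_cast
    have h2 := norm_inner_le_norm (𝕜 := ℂ) ((T * star T) z) z
    rw [h, Complex.norm_real, Real.norm_of_nonneg (by positivity)] at h2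
    exact h2
  have hTB := (isCompactOperator_iff_isCompact_closure_image_ball
    ((T * star T : H →L[ℂ] H) : H →ₗ[ℂ] H) one_pos).1 hTT
  refine (isCompactOperator_iff_isCompact_closure_image_ball
    ((star T : H →L[ℂ] H) : H →ₗ[ℂ] H) one_pos).2 ?_
  have htb := hTB.totallyBounded.subset subset_closure
  refine (TotallyBounded.closure ?_).isCompact_of_isClosed isClosed_closure
  rw [Metric.totallyBounded_iff] at htb ⊢
  intro ε hε
  obtain ⟨t, htsub, htfin, ht⟩ := Metric.finite_approx_of_totallyBounded
    (Metric.totallyBounded_iff.2 htb) (ε ^ 2 / 2) (by positivity)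
  have htsub' : ∀ y ∈ t, ∃ z : H, z ∈ Metric.ball (0 : H) 1 ∧ (T * star T : H →L[ℂ] H) z = y :=
    fun y hy => htsub hy
  choose! g hg using htsub'
  refine ⟨(fun y => (star T) (g y)) '' t, htfin.image _, ?_⟩
  rintro _ ⟨z, hz, rfl⟩
  obtain ⟨y, hy, hyz⟩ := Set.mem_iUnion₂.1 (ht ⟨z, hz, rfl⟩)
  refine Set.mem_iUnion₂.2 ⟨_, ⟨y, hy, rfl⟩, ?_⟩
  obtain ⟨hgb, hgy⟩ := hg y hy
  rw [Metric.mem_ball, dist_eq_norm] at hyz ⊢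
  rw [← hgy] at hyz
  have hn : ‖z - g y‖ ≤ 2 := by
    have h1 : ‖z‖ < 1 := by simpa using hz
    have h2 : ‖g y‖ < 1 := by simpa using hgb
    linarith [norm_sub_le z (g y)]
  have h3 := key (z - g y)
  have h4 : ‖(T * star T) (z - g y)‖ < ε ^ 2 / 2 := by
    rw [map_sub]; exact hyz
  have h5 : ‖(star T) (z - g y)‖ ^ 2 < ε ^ 2 := by
    nlinarith [norm_nonneg (z - g y), norm_nonneg ((T * star T) (z - g y))]
  have h6 := lt_of_pow_lt_pow_left₀ 2 hε.le h5
  rw [map_sub] at h6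
  exact h6

variable (H) in
/-- The C⋆-algebra of compact operators on the Hilbert space `H`. -/
def compactOperators : NonUnitalStarSubalgebra ℂ (H →L[ℂ] H) where
  carrier := {T | IsCompactOperator T}
  add_mem' hS hT := hS.add hT
  zero_mem' := isCompactOperator_zero
  smul_mem' c _ hT := hT.smul c
  mul_mem' {_ T} hS _ := hS.comp_clm T
  star_mem' hT := isCompactOperator_star hT

instance : IsClosed (compactOperators H : Set (H →L[ℂ] H)) :=
  isClosed_setOfPred_isCompactOperator

end Compact

/-- `𝕂`, the compact operators on `ℓ²(ℕ)`. -/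
abbrev K : NonUnitalStarSubalgebra ℂ
    (lp (fun _ : ℕ => ℂ) 2 →L[ℂ] lp (fun _ : ℕ => ℂ) 2) :=
  compactOperators (lp (fun _ : ℕ => ℂ) 2)

/-- The full Fock space over `ℓ²(ℕ)`, i.e. the Hilbert space with orthonormal basis
`δ_w = lp.single 2 w 1` indexed by the finite words `w` in the alphabet `ℕ`. -/
abbrev Fock : Type := lp (fun _ : List ℕ => ℂ) 2

/-- The isometric embedding `ℂ → Fock`, `c ↦ c δ_w`. -/
def fockSingle (w : List ℕ) : ℂ →ₗᵢ[ℂ] Fock where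
  toFun c := lp.single 2 w c
  map_add' c d := lp.single_add (E := fun _ : List ℕ => ℂ) 2 w c d
  map_smul' a c := lp.single_smul (E := fun _ : List ℕ => ℂ) 2 w a c
  norm_map' c := by
    have h : (0 : ℝ≥0∞) < 2 := two_pos
    exact lp.norm_single (E := fun _ : List ℕ => ℂ) h w c

theorem orthogonalFamily_cons (n : ℕ) :
    OrthogonalFamily ℂ (fun _ : List ℕ => ℂ) (fun w : List ℕ => fockSingle (n :: w)) := by
  intro v w hvw c d
  have h : (n :: v) ≠ (n :: w) := fun h => hvw (List.cons.inj h).2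
  change inner ℂ (lp.single 2 (n :: v) c : Fock) (lp.single 2 (n :: w) d) = 0
  rw [lp.inner_single_left, lp.single_apply_ne _ _ _ h, inner_zero_right]

/-- The left creation operator `S_n δ_w = δ_{n w}` on Fock space. -/
def creation (n : ℕ) : Fock →L[ℂ] Fock :=
  (orthogonalFamily_cons n).linearIsometry.toContinuousLinearMap

/-- The Cuntz algebra `O_∞`: the C⋆-algebra generated by the sequence of isometries
`S_0, S_1, …`, whose ranges are pairwise orthogonal. By Cuntz's theorem the C⋆-algebra generated
by such a sequence does not depend on the choice of the isometries. -/
def CuntzInfinity : StarSubalgebra ℂ (Fock →L[ℂ] Fock) :=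
  (StarAlgebra.adjoin ℂ (Set.range creation)).topologicalClosure

instance : IsClosed (CuntzInfinity : Set (Fock →L[ℂ] Fock)) :=
  StarSubalgebra.isClosed_topologicalClosure _

/-- The formula `S_n δ_w = δ_{n w}`. -/
theorem creation_single (n : ℕ) (w : List ℕ) (c : ℂ) :
    creation n (lp.single 2 w c) = lp.single 2 (n :: w) c := by
  exact (orthogonalFamily_cons n).linearIsometry_apply_single c

/-! ### Tensor products, stability, `O_∞`-stability -/

/-- `T` is a C⋆-tensor product of `A` and `B`: a completion of the algebraic tensor product
⋆-algebra `A ⊙ B` in some C⋆-norm, i.e. there is an injective ⋆-homomorphism `A ⊙ B → T` with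
dense range. If one of `A`, `B` is nuclear (here it is always `𝕂` or `O_∞`), there is just one
C⋆-norm on `A ⊙ B`, so that this says `T ≅ A ⊗ B`. -/
def IsCStarTensorProduct (A B T : Type*) [NonUnitalCStarAlgebra A] [NonUnitalCStarAlgebra B]
    [NonUnitalCStarAlgebra T] : Prop :=
  ∃ φ : (A ⊗[ℂ] B) →⋆ₙₐ[ℂ] T, Function.Injective φ ∧ DenseRange φ

/-- A C⋆-algebra `D` is stable if `D ≅ D ⊗ 𝕂`. -/
def IsStable (D : Type*) [NonUnitalCStarAlgebra D] : Prop :=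
  IsCStarTensorProduct D K D

/-- A C⋆-algebra `B` is `O_∞`-stable if `B ≅ B ⊗ O_∞`. -/
def IsCuntzInfinityStable (B : Type*) [NonUnitalCStarAlgebra B] : Prop :=
  IsCStarTensorProduct B CuntzInfinity B

/-- A C⋆-algebra is `σ`-unital if it has a countable approximate unit, consisting of positive
contractions. -/
def IsSigmaUnital (D : Type*) [NonUnitalCStarAlgebra D] : Prop :=
  ∃ u : ℕ → D, (∀ n, ∃ v : D, u n = star v * v) ∧ (∀ n, ‖u n‖ ≤ 1) ∧
    (∀ d, Tendsto (fun n => u n * d) atTop (𝓝 d)) ∧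
    (∀ d, Tendsto (fun n => d * u n) atTop (𝓝 d))

/-! ### Extensions -/

/-- An extension `0 → J → A → B → 0` of C⋆-algebras. -/
structure Extension (J A B : Type*) [NonUnitalCStarAlgebra J] [NonUnitalCStarAlgebra A]
    [NonUnitalCStarAlgebra B] where
  /-- the inclusion `J → A` -/
  ι : J →⋆ₙₐ[ℂ] A
  /-- the quotient map `A → B` -/
  π : A →⋆ₙₐ[ℂ] B
  injective : Function.Injective ι
  exact : Function.Exact ι π
  surjective : Function.Surjective π

/-- An extension `0 → J → A → B → 0` is purely large if for every `a ∈ A \ J` the hereditary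
subalgebra `closure (a J a⋆)` of `J` contains a `σ`-unital, stable C⋆-subalgebra `D` which is full
in `J`, i.e. generates `J` as an ideal. -/
def Extension.IsPurelyLarge {J A B : Type*} [NonUnitalCStarAlgebra J] [NonUnitalCStarAlgebra A]
    [NonUnitalCStarAlgebra B] (E : Extension J A B) : Prop :=
  ∀ a : A, a ∉ Set.range E.ι →
    ∃ (D : NonUnitalStarSubalgebra ℂ J) (_ : IsClosed (D : Set J)),
      (∀ d ∈ D, E.ι d ∈ closure (Set.range fun j : J => a * E.ι j * star a)) ∧
      IsStable D ∧ IsSigmaUnital D ∧ closedIdeal (D : Set J) = ⊤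

/-! ### Ultraproducts -/

section Ultraproduct

universe u v

variable (ω : Ultrafilter ℕ)

/-- The sequences in the product `∏ A_i` whose norms tend to `0` along `ω`. -/
def nullSequences (A : ℕ → Type u) [∀ i, NonUnitalCStarAlgebra (A i)] :
    Submodule ℂ (lp A ∞) where
  carrier := {a | Tendsto (fun i => ‖a i‖) ω (𝓝 0)}
  zero_mem' := by simp
  add_mem' {a b} ha hb := by
    refine squeeze_zero (fun _ => norm_nonneg _) (fun i => ?_) (by simpa using ha.add hb)
    exact norm_add_le (a i) (b i)
  smul_mem' c a ha := by
    have := ha.const_mul ‖c‖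
    simpa [norm_smul] using this

/-- The ultraproduct `∏_{i → ω} A_i`: the C⋆-algebra `lp A ∞` of bounded sequences modulo the
sequences tending to `0` in norm along `ω`. -/
def Ultraproduct (A : ℕ → Type u) [∀ i, NonUnitalCStarAlgebra (A i)] : Type u :=
  lp A ∞ ⧸ nullSequences ω A

namespace Ultraproduct

variable {A : ℕ → Type u} [∀ i, NonUnitalCStarAlgebra (A i)]
variable {B : ℕ → Type v} [∀ i, NonUnitalCStarAlgebra (B i)]

theorem mem_nullSequences {a : lp A ∞} :
    a ∈ nullSequences ω A ↔ Tendsto (fun i => ‖a i‖) ω (𝓝 0) := Iff.rfl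

theorem mul_mem_left (a : lp A ∞) {b : lp A ∞} (hb : b ∈ nullSequences ω A) :
    a * b ∈ nullSequences ω A := by
  rw [mem_nullSequences] at hb ⊢
  refine squeeze_zero (fun _ => norm_nonneg _) (fun i => ?_) (by simpa using hb.const_mul ‖a‖)
  exact (norm_mul_le _ _).trans
    (mul_le_mul_of_nonneg_right (lp.norm_apply_le_norm ENNReal.top_ne_zero a i) (norm_nonneg _))

theorem mul_mem_right (b : lp A ∞) {a : lp A ∞} (ha : a ∈ nullSequences ω A) :
    a * b ∈ nullSequences ω A := by
  rw [mem_nullSequences] at ha ⊢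
  refine squeeze_zero (fun _ => norm_nonneg _) (fun i => ?_) (by simpa using ha.mul_const ‖b‖)
  exact (norm_mul_le _ _).trans
    (mul_le_mul_of_nonneg_left (lp.norm_apply_le_norm ENNReal.top_ne_zero b i) (norm_nonneg _))

theorem star_mem {a : lp A ∞} (ha : a ∈ nullSequences ω A) : star a ∈ nullSequences ω A := by
  rw [mem_nullSequences] at ha ⊢
  simpa using ha

instance isClosed_nullSequences : IsClosed (nullSequences ω A : Set (lp A ∞)) := by
  refine isClosed_of_closure_subset fun a ha => ?_
  change Tendsto (fun i => ‖a i‖) ω (𝓝 0)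
  rw [Metric.tendsto_nhds]
  intro ε hε
  obtain ⟨b, hb, hab⟩ := Metric.mem_closure_iff.1 ha (ε / 2) (by positivity)
  have hb' : Tendsto (fun i => ‖b i‖) ω (𝓝 0) := hb
  filter_upwards [hb'.eventually (gt_mem_nhds (half_pos hε))] with i hi
  have h1 : ‖a i - b i‖ ≤ ‖a - b‖ := lp.norm_apply_le_norm ENNReal.top_ne_zero (a - b) i
  rw [dist_eq_norm] at hab
  have h2 := norm_le_norm_add_norm_sub' (a i) (b i)
  simp only [dist_zero_right, norm_norm]
  linarith

instance : NormedAddCommGroup (Ultraproduct ω A) :=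
  inferInstanceAs (NormedAddCommGroup (lp A ∞ ⧸ nullSequences ω A))

instance : NormedSpace ℂ (Ultraproduct ω A) :=
  inferInstanceAs (NormedSpace ℂ (lp A ∞ ⧸ nullSequences ω A))

instance : CompleteSpace (Ultraproduct ω A) :=
  inferInstanceAs (CompleteSpace (lp A ∞ ⧸ nullSequences ω A))

/-- The class of a bounded sequence in the ultraproduct. -/
def mk : lp A ∞ →ₗ[ℂ] Ultraproduct ω A := (nullSequences ω A).mkQ

theorem mk_surjective : Function.Surjective (mk ω : lp A ∞ → Ultraproduct ω A) :=
  (nullSequences ω A).mkQ_surjective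

theorem mk_eq_mk {a b : lp A ∞} : mk ω a = mk ω b ↔ a - b ∈ nullSequences ω A :=
  Submodule.Quotient.eq _

theorem norm_mk_le (a : lp A ∞) : ‖mk ω a‖ ≤ ‖a‖ := Submodule.Quotient.norm_mk_le _ a

theorem exists_norm_lt (x : Ultraproduct ω A) {ε : ℝ} (hε : 0 < ε) :
    ∃ a, mk ω a = x ∧ ‖a‖ < ‖x‖ + ε := Submodule.Quotient.norm_mk_lt x hε

instance : Mul (Ultraproduct ω A) where
  mul := Quotient.map₂ (· * ·) (by
    intro a a' ha b b' hb
    have ha' : a - a' ∈ nullSequences ω A := (Submodule.quotientRel_def _).1 ha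
    have hb' : b - b' ∈ nullSequences ω A := (Submodule.quotientRel_def _).1 hb
    refine (Submodule.quotientRel_def _).2 ?_
    have h : a * b - a' * b' = (a - a') * b + a' * (b - b') := by
      rw [sub_mul, mul_sub]; abel
    rw [h]
    exact add_mem (mul_mem_right ω _ ha') (mul_mem_left ω _ hb'))

instance : Star (Ultraproduct ω A) where
  star := Quotient.map star (by
    intro a a' ha
    have ha' : a - a' ∈ nullSequences ω A := (Submodule.quotientRel_def _).1 ha
    refine (Submodule.quotientRel_def _).2 ?_
    rw [← star_sub]
    exact star_mem ω ha')

theorem mk_mul (a b : lp A ∞) : mk ω (a * b) = mk ω a * mk ω b := rfl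

theorem mk_star (a : lp A ∞) : mk ω (star a) = star (mk ω a) := rfl

theorem norm_mk_le_of_eventually {a : lp A ∞} {c : ℝ} (hc : 0 ≤ c)
    (h : ∀ᶠ i in (ω : Filter ℕ), ‖a i‖ ≤ c) : ‖mk ω a‖ ≤ c := by
  classical
  have hb : Memℓp (fun i => if ‖a i‖ ≤ c then a i else 0) ∞ := by
    refine memℓp_infty ⟨c, ?_⟩
    rintro _ ⟨i, rfl⟩
    dsimp only
    split_ifs with hi
    · exact hi
    · simpa using hc
  let b : lp A ∞ := ⟨_, hb⟩
  have hab : mk ω a = mk ω b := by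
    rw [mk_eq_mk, mem_nullSequences]
    refine tendsto_const_nhds.congr' ?_
    filter_upwards [h] with i hi
    have : b i = a i := if_pos hi
    change (0 : ℝ) = ‖a i - b i‖
    rw [this, sub_self, norm_zero]
  rw [hab]
  refine (norm_mk_le ω b).trans (lp.norm_le_of_forall_le hc fun i => ?_)
  change ‖if ‖a i‖ ≤ c then a i else 0‖ ≤ c
  split_ifs with hi
  · exact hi
  · simpa using hc

instance : NonUnitalNormedRing (Ultraproduct ω A) where
  __ := (inferInstance : NormedAddCommGroup (Ultraproduct ω A))
  __ := (inferInstance : Mul (Ultraproduct ω A))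
  left_distrib x y z := by
    obtain ⟨a, rfl⟩ := mk_surjective ω x
    obtain ⟨b, rfl⟩ := mk_surjective ω y
    obtain ⟨c, rfl⟩ := mk_surjective ω z
    rw [← map_add, ← mk_mul, mul_add, map_add]; rfl
  right_distrib x y z := by
    obtain ⟨a, rfl⟩ := mk_surjective ω x
    obtain ⟨b, rfl⟩ := mk_surjective ω y
    obtain ⟨c, rfl⟩ := mk_surjective ω z
    rw [← map_add, ← mk_mul, add_mul, map_add]; rfl
  zero_mul x := by
    obtain ⟨a, rfl⟩ := mk_surjective ω x
    rw [← map_zero (mk ω), ← mk_mul, zero_mul]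
  mul_zero x := by
    obtain ⟨a, rfl⟩ := mk_surjective ω x
    rw [← map_zero (mk ω), ← mk_mul, mul_zero]
  mul_assoc x y z := by
    obtain ⟨a, rfl⟩ := mk_surjective ω x
    obtain ⟨b, rfl⟩ := mk_surjective ω y
    obtain ⟨c, rfl⟩ := mk_surjective ω z
    simp only [← mk_mul, mul_assoc]
  norm_mul_le x y := by
    refine le_of_forall_pos_le_add fun ε hε => ?_
    have hcont : Tendsto (fun δ : ℝ => (‖x‖ + δ) * (‖y‖ + δ)) (𝓝[>] 0) (𝓝 (‖x‖ * ‖y‖)) := by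
      have : Continuous fun δ : ℝ => (‖x‖ + δ) * (‖y‖ + δ) := by fun_prop
      simpa using (this.tendsto 0).mono_left nhdsWithin_le_nhds
    obtain ⟨δ, hδ, hδ0⟩ := ((hcont.eventually (gt_mem_nhds (lt_add_of_pos_right _ hε))).and
      self_mem_nhdsWithin).exists
    obtain ⟨a, rfl, ha⟩ := exists_norm_lt ω x hδ0
    obtain ⟨b, rfl, hb⟩ := exists_norm_lt ω y hδ0
    have h1 : ‖mk ω a * mk ω b‖ ≤ ‖a * b‖ := norm_mk_le ω (a * b)
    have h2 := norm_mul_le a b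
    have h3 := mul_le_mul ha.le hb.le (norm_nonneg b) ((norm_nonneg a).trans ha.le)
    linarith

instance : StarRing (Ultraproduct ω A) where
  star_involutive x := by
    obtain ⟨a, rfl⟩ := mk_surjective ω x
    rw [← mk_star, ← mk_star, star_star]
  star_mul x y := by
    obtain ⟨a, rfl⟩ := mk_surjective ω x
    obtain ⟨b, rfl⟩ := mk_surjective ω y
    simp only [← mk_mul, ← mk_star, star_mul]
  star_add x y := by
    obtain ⟨a, rfl⟩ := mk_surjective ω x
    obtain ⟨b, rfl⟩ := mk_surjective ω y
    rw [← map_add, ← mk_star, star_add, map_add]; rfl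

instance : CStarRing (Ultraproduct ω A) where
  norm_mul_self_le x := by
    obtain ⟨a, rfl⟩ := mk_surjective ω x
    rw [← mk_star, ← mk_mul]
    refine le_of_forall_pos_le_add fun ε hε => ?_
    obtain ⟨b, hb, hbn⟩ := exists_norm_lt ω (mk ω (star a * a)) (half_pos hε)
    rw [eq_comm, mk_eq_mk, mem_nullSequences] at hb
    have hs : 0 ≤ ‖mk ω (star a * a)‖ + ε := by positivity
    have h : ‖mk ω a‖ ≤ Real.sqrt (‖mk ω (star a * a)‖ + ε) := by
      refine norm_mk_le_of_eventually ω (Real.sqrt_nonneg _) ?_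
      filter_upwards [hb.eventually (gt_mem_nhds (half_pos hε))] with i hi
      refine Real.le_sqrt_of_sq_le ?_
      have h1 : ‖b i‖ ≤ ‖b‖ := lp.norm_apply_le_norm ENNReal.top_ne_zero b i
      have h2 : ‖star (a i) * a i - b i‖ < ε / 2 := hi
      have h3 := norm_le_norm_add_norm_sub' (star (a i) * a i) (b i)
      rw [CStarRing.norm_star_mul_self] at h3
      rw [sq]
      linarith
    calc ‖mk ω a‖ * ‖mk ω a‖ ≤ Real.sqrt _ * Real.sqrt _ :=
          mul_self_le_mul_self (norm_nonneg _) h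
      _ = _ := Real.mul_self_sqrt hs

instance : IsScalarTower ℂ (Ultraproduct ω A) (Ultraproduct ω A) where
  smul_assoc c x y := by
    obtain ⟨a, rfl⟩ := mk_surjective ω x
    obtain ⟨b, rfl⟩ := mk_surjective ω y
    change (c • mk ω a) * mk ω b = c • (mk ω a * mk ω b)
    rw [← map_smul, ← mk_mul, ← mk_mul, ← map_smul, smul_mul_assoc]

instance : SMulCommClass ℂ (Ultraproduct ω A) (Ultraproduct ω A) where
  smul_comm c x y := by
    obtain ⟨a, rfl⟩ := mk_surjective ω x
    obtain ⟨b, rfl⟩ := mk_surjective ω y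
    change c • (mk ω a * mk ω b) = mk ω a * (c • mk ω b)
    rw [← map_smul, ← mk_mul, ← mk_mul, ← map_smul, mul_smul_comm]

instance : StarModule ℂ (Ultraproduct ω A) where
  star_smul c x := by
    obtain ⟨a, rfl⟩ := mk_surjective ω x
    rw [← map_smul, ← mk_star, star_smul, map_smul]; rfl

instance : NonUnitalCStarAlgebra (Ultraproduct ω A) where

/-- The ⋆-homomorphism `(a_i)_i ↦ (φ_i (a_i))_i` between products of C⋆-algebras. -/
def prodMap (φ : ∀ i, A i →⋆ₙₐ[ℂ] B i) : lp A ∞ →⋆ₙₐ[ℂ] lp B ∞ where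
  toFun a := ⟨fun i => φ i (a i), memℓp_infty ⟨‖a‖, by
    rintro _ ⟨i, rfl⟩
    exact (NonUnitalStarAlgHom.norm_apply_le (φ i) (a i)).trans
      (lp.norm_apply_le_norm ENNReal.top_ne_zero a i)⟩⟩
  map_smul' c a := by ext i; exact map_smul (φ i) c (a i)
  map_zero' := by ext i; exact map_zero (φ i)
  map_add' a b := by ext i; exact map_add (φ i) (a i) (b i)
  map_mul' a b := by ext i; exact map_mul (φ i) (a i) (b i)
  map_star' a := by ext i; exact map_star (φ i) (a i)

theorem prodMap_mem (φ : ∀ i, A i →⋆ₙₐ[ℂ] B i) {a : lp A ∞} (ha : a ∈ nullSequences ω A) :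
    prodMap φ a ∈ nullSequences ω B :=
  squeeze_zero (fun _ => norm_nonneg _)
    (fun i => NonUnitalStarAlgHom.norm_apply_le (φ i) (a i)) ha

/-- The ⋆-homomorphism `φ_ω : ∏_{i → ω} A_i → ∏_{i → ω} B_i`, `[(a_i)_i] ↦ [(φ_i (a_i))_i]`,
induced by a sequence of ⋆-homomorphisms `φ_i : A_i → B_i`. -/
def map (φ : ∀ i, A i →⋆ₙₐ[ℂ] B i) : Ultraproduct ω A →⋆ₙₐ[ℂ] Ultraproduct ω B where
  toFun := Quotient.map (prodMap φ) (by
    intro a a' ha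
    have ha' : a - a' ∈ nullSequences ω A := (Submodule.quotientRel_def _).1 ha
    refine (Submodule.quotientRel_def _).2 ?_
    rw [← map_sub]
    exact prodMap_mem ω φ ha')
  map_smul' c x := by
    obtain ⟨a, rfl⟩ := mk_surjective ω x
    exact congrArg (mk ω) (map_smul (prodMap φ) c a)
  map_zero' := congrArg (mk ω) (map_zero (prodMap φ))
  map_add' x y := by
    obtain ⟨a, rfl⟩ := mk_surjective ω x
    obtain ⟨b, rfl⟩ := mk_surjective ω y
    exact congrArg (mk ω) (map_add (prodMap φ) a b)
  map_mul' x y := by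
    obtain ⟨a, rfl⟩ := mk_surjective ω x
    obtain ⟨b, rfl⟩ := mk_surjective ω y
    exact congrArg (mk ω) (map_mul (prodMap φ) a b)
  map_star' x := by
    obtain ⟨a, rfl⟩ := mk_surjective ω x
    exact congrArg (mk ω) (map_star (prodMap φ) a)

theorem map_mk (φ : ∀ i, A i →⋆ₙₐ[ℂ] B i) (a : lp A ∞) :
    map ω φ (mk ω a) = mk ω (prodMap φ a) := rfl

end Ultraproduct

end Ultraproduct

end PurelyLarge

end

/-!
Write `J_ω`, `A_ω`, `B_ω` for the ultraproducts, and let `I` be the closed ideal of `A_ω` generated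
by `y`. Since norms can be preserved when lifting along a surjective ⋆-homomorphism
(`exists_lift_norm_le`), the sequence `0 → J_ω → A_ω → B_ω → 0` is exact. If `J_ω ⊆ I`, then the
image of `I` in `B_ω` is a closed ideal, because the quotient map is open and `I` is the preimage of
this image; so it contains `π_ω(x)`, and `x ∈ I` (`mem_closedIdeal_of_map_mem`). Thus it is enough
to show that `J_ω ⊆ I` as soon as `π_ω(y) ≠ 0` (`map_mem_closedIdeal`).

As `J_ω` is spanned by positive elements, only the elements `s⋆s` with `s ∈ J_ω` matter. For
`ω`-almost all `i` the norm of `π_i(y_i)` is bounded below, so functional calculus of `y_i⋆y_i`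
provides an `a_i ∉ J_i` and an `h_i`, bounded uniformly in `i`, such that `g_i = h_i y_i⋆y_i`
satisfies `g_i a_i = a_i` (`exists_cutoff`). If there are `f_i ∈ J_i` with `f_i⋆f_i ≈ s_i⋆s_i` and
`g_i f_i = f_i`, then these are automatically bounded, and in the ultraproduct
`s⋆s = f⋆f = f⋆ h y⋆y f ∈ I`.

The existence of `f_i` is what pure largeness is for (`Extension.IsPurelyLarge.exists_approx`). Let
`D` be the full stable subalgebra of the closure of `a J a⋆`; then `g d = d` for `d ∈ D`. By
fullness `s` is close to a finite sum `t = ∑ (d_k u_k)⋆ (e_k v_k)` with `d_k`, `e_k` in a dense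
subset of `D`. Stability yields, on a dense subset of `D`, shifts `σ_k` that act like isometries with
orthogonal ranges, so that `t = c⋆e` for the single elements `c = ∑ σ_k(d_k) u_k` and
`e = ∑ σ_k(e_k) v_k`. Neither `c` nor `e` is bounded in terms of `s`, but `f = (c c⋆)^{1/2} e`
satisfies `f⋆f = t⋆t ≈ s⋆s`, and `g c = c` implies `g f = f`.
-/

namespace PurelyLarge

/-! ### Functional calculus in a C⋆-algebra -/

section FunctionalCalculus

variable {A B : Type*} [NonUnitalCStarAlgebra A] [NonUnitalCStarAlgebra B]

/-- Surjective ⋆-homomorphisms admit lifts without increase of the norm: an arbitrary lift `a` is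
replaced by `a - a m(a⋆a)`, where `m` vanishes on `[-‖b‖ ^ 2, ‖b‖ ^ 2]` and
`|t| (1 - m t) ^ 2 ≤ ‖b‖ ^ 2` for all `t`. -/
theorem exists_lift_norm_le (π : A →⋆ₙₐ[ℂ] B) (hπ : Function.Surjective π) (b : B) :
    ∃ a, π a = b ∧ ‖a‖ ≤ ‖b‖ := by
  rcases eq_or_ne b 0 with rfl | hb
  · exact ⟨0, map_zero π, by simp⟩
  obtain ⟨a, rfl⟩ := hπ b
  have hl : 0 < ‖π a‖ ^ 2 := by positivity
  set l := ‖π a‖ ^ 2 with hl_def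
  set m : ℝ → ℝ := fun t => max (|t| - l) 0 / max |t| l with hm
  have hden : ∀ t : ℝ, max |t| l ≠ 0 := fun t => (lt_max_of_lt_right hl).ne'
  have hmc : Continuous m := by
    refine Continuous.div (by fun_prop) (by fun_prop) hden
  have hm0 : m 0 = 0 := by simp [hm, hl.le]
  set P := star a * a with hP
  have hPsa : IsSelfAdjoint P := IsSelfAdjoint.star_mul_self a
  set M := cfcₙ m P with hM
  have hMsa : star M = M := (cfcₙ_predicate (p := IsSelfAdjoint) m P).star_eq
  have hid : cfcₙ (fun t : ℝ => t) P = P := cfcₙ_id' ℝ P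
  refine ⟨a - a * M, ?_, ?_⟩
  · have hcont : Continuous π := (NonUnitalStarAlgHom.instContinuousLinearMapClassComplex
      (F := A →⋆ₙₐ[ℂ] B) (A := A) (B := B)).map_continuous π
    have hM0 : π M = 0 := by
      have hsa : IsSelfAdjoint (π P) := by
        rw [hP, map_mul, map_star]; exact IsSelfAdjoint.star_mul_self _
      rw [hM, NonUnitalStarAlgHom.map_cfcₙ π m P hmc.continuousOn hm0 hcont hPsa hsa,
        ← norm_le_zero_iff]
      refine norm_cfcₙ_le fun t ht => ?_
      have h1 : ‖t‖ ≤ ‖cfcₙ (fun t : ℝ => t) (π P)‖ :=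
        norm_apply_le_norm_cfcₙ (fun t : ℝ => t) (π P) ht
      rw [cfcₙ_id' ℝ (π P), hP, map_mul, map_star, CStarRing.norm_star_mul_self, ← sq,
        Real.norm_eq_abs] at h1
      have h2 : m t = 0 := by
        rw [hm]
        dsimp only
        rw [max_eq_right (sub_nonpos.2 h1), zero_div]
      rw [h2, norm_zero]
    rw [map_sub, map_mul, hM0, mul_zero, sub_zero]
  · have h1 : star (a - a * M) * (a - a * M) =
        cfcₙ (fun t : ℝ => t - t * m t - (m t * t - m t * t * m t)) P := by
      have hc : ∀ s : Set ℝ, ContinuousOn m s := fun s => hmc.continuousOn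
      have hI : ∀ s : Set ℝ, ContinuousOn (fun t : ℝ => t) s := fun s => continuousOn_id
      rw [cfcₙ_sub (fun t => t - t * m t) (fun t => m t * t - m t * t * m t) P
          ((hI _).sub ((hI _).mul (hc _))) (by simp)
          (((hc _).mul (hI _)).sub (((hc _).mul (hI _)).mul (hc _))) (by simp),
        cfcₙ_sub (fun t => t) (fun t => t * m t) P (hI _) rfl ((hI _).mul (hc _)) (by simp),
        cfcₙ_sub (fun t => m t * t) (fun t => m t * t * m t) P ((hc _).mul (hI _)) (by simp)
          (((hc _).mul (hI _)).mul (hc _)) (by simp),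
        cfcₙ_mul (fun t => t) m P (hI _) rfl (hc _) hm0,
        cfcₙ_mul (fun t => m t * t) m P ((hc _).mul (hI _)) (by simp) (hc _) hm0,
        cfcₙ_mul m (fun t => t) P (hc _) hm0 (hI _) rfl, hid, star_sub, star_mul, hMsa]
      rw [← hM, sub_mul, mul_sub, mul_sub, hP]
      simp only [mul_assoc]
    have h2 : ‖a - a * M‖ ^ 2 ≤ l := by
      rw [sq, ← CStarRing.norm_star_mul_self, h1]
      refine norm_cfcₙ_le fun t _ => ?_
      have h3 : t - t * m t - (m t * t - m t * t * m t) = t * (l / max |t| l) ^ 2 := by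
        have : 1 - m t = l / max |t| l := by
          rw [hm]
          field_simp [hden t]
          rcases le_total |t| l with h | h
          · simp [h]
          · simp [h]
        rw [← this]; ring
      rw [h3, norm_mul, Real.norm_eq_abs, norm_pow, Real.norm_of_nonneg (by positivity), div_pow,
        mul_div_assoc', div_le_iff₀ (by positivity)]
      have h4 : |t| ≤ max |t| l := le_max_left _ _
      have h5 : l ≤ max |t| l := le_max_right _ _
      nlinarith [mul_le_mul h4 h5 hl.le (by positivity), abs_nonneg t]
    exact le_of_sq_le_sq h2 (norm_nonneg _)

/-- If `π (y)` is bounded below in norm, then `y` has a cut-off `a` outside the kernel of `π` with a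
left unit of the form `h y⋆y`, where the norm of `h` is controlled by the lower bound alone. -/
theorem exists_cutoff (π : A →⋆ₙₐ[ℂ] B) {κ : ℝ} (hκ : 0 < κ) (y : A) (hy : κ < ‖π y‖ ^ 2) :
    ∃ a h : A, π a ≠ 0 ∧ ‖h‖ ≤ κ⁻¹ ∧ h * (star y * y) * a = a := by
  set P := star y * y with hP
  have hPsa : IsSelfAdjoint P := IsSelfAdjoint.star_mul_self y
  have hid : cfcₙ (fun t : ℝ => t) P = P := cfcₙ_id' ℝ P
  have hden : ∀ t : ℝ, 0 < max |t| κ := fun t => lt_max_of_lt_right hκ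
  set c : ℝ → ℝ := fun t => max (-κ) (min κ t) with hc
  set g : ℝ → ℝ := fun t => t / max |t| κ ^ 2 with hg
  have hcc : Continuous c := by fun_prop
  have hgc : Continuous g :=
    Continuous.div (by fun_prop) (by fun_prop) fun t => pow_ne_zero 2 (hden t).ne'
  have hc0 : c 0 = 0 := by simp [hc, hκ.le]
  have hg0 : g 0 = 0 := by simp [hg]
  have hI : ∀ s : Set ℝ, ContinuousOn (fun t : ℝ => t) s := fun s => continuousOn_id
  refine ⟨cfcₙ (fun t => t - c t) P, cfcₙ g P, fun h0 => ?_, ?_, ?_⟩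
  · rw [cfcₙ_sub (fun t => t) c P (hI _) rfl hcc.continuousOn hc0, hid, map_sub,
      sub_eq_zero] at h0
    have h1 : ‖cfcₙ c P‖ ≤ κ := by
      refine norm_cfcₙ_le fun t _ => ?_
      rw [Real.norm_eq_abs, abs_le]
      exact ⟨le_max_left _ _, max_le (by linarith) (min_le_left _ _)⟩
    have h2 := (NonUnitalStarAlgHom.norm_apply_le π (cfcₙ c P)).trans h1
    rw [← h0, hP, map_mul, map_star, CStarRing.norm_star_mul_self, ← sq] at h2
    exact hy.not_ge h2
  · refine norm_cfcₙ_le fun t _ => ?_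
    rw [hg, norm_div, Real.norm_eq_abs, norm_pow, Real.norm_of_nonneg (hden t).le,
      div_le_iff₀ (pow_pos (hden t) 2), inv_mul_eq_div, le_div_iff₀ hκ, sq]
    exact mul_le_mul (le_max_left _ _) (le_max_right _ _) hκ.le (hden t).le
  · have h1 : cfcₙ g P * P * cfcₙ (fun t => t - c t) P =
        cfcₙ (fun t => g t * t * (t - c t)) P := by
      rw [cfcₙ_mul (fun t => g t * t) (fun t => t - c t) P (hgc.continuousOn.mul (hI _)) (by simp)
        ((hI _).sub hcc.continuousOn) (by simp [hc0]),
        cfcₙ_mul g (fun t => t) P hgc.continuousOn hg0 (hI _) rfl, hid]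
    rw [h1]
    congr 1
    funext t
    rcases le_total |t| κ with h | h
    · have h2 := abs_le.1 h
      have : c t = t := by simp [hc, h2.1, h2.2]
      rw [this]; simp
    · have : g t * t = 1 := by
        have ht : |t| ^ 2 ≠ 0 := pow_ne_zero 2 (hκ.trans_le h).ne'
        rw [hg]
        dsimp only
        rw [max_eq_left h, div_mul_eq_mul_div, ← sq, ← sq_abs t, div_self ht]
      rw [this, one_mul]

/-- The element `f = (c c⋆)^{1/2} e` has `f⋆f = (c⋆e)⋆(c⋆e)`, and it inherits from `c` the left
units. -/
theorem exists_star_mul_self_eq {J : Type*} [NonUnitalCStarAlgebra J] (ι : J →⋆ₙₐ[ℂ] A)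
    (c e : J) {g : A} (hg : g * ι c = ι c) :
    ∃ f : J, g * ι f = ι f ∧ star f * f = star (star c * e) * (star c * e) := by
  let _ := CStarAlgebra.spectralOrder J
  have _ := CStarAlgebra.spectralOrderedRing J
  set r := CFC.abs (star c) with hr
  have hrr : r * r = c * star c := by rw [hr, CFC.abs_mul_abs, star_star]
  have hrs : star r = r := (CFC.abs_nonneg (star c)).isSelfAdjoint.star_eq
  refine ⟨r * e, ?_, ?_⟩
  · have h1 : g * ι r = ι r := by
      rw [← sub_eq_zero, ← CStarRing.mul_star_self_eq_zero_iff]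
      have h2 : g * (ι r * ι r) = ι r * ι r := by
        rw [← map_mul, hrr, map_mul, ← mul_assoc, hg]
      have h3 : ι r * ι r * star g = ι r * ι r := by
        have := congrArg star h2
        simpa only [star_mul, ← map_star, hrs] using this
      rw [star_sub, star_mul, ← map_star, hrs, sub_mul, mul_sub, mul_sub, ← mul_assoc (g * ι r),
        mul_assoc g, h2, ← mul_assoc (ι r), h3, sub_self]
    rw [map_mul, ← mul_assoc, h1]
  · rw [star_mul, hrs, mul_assoc, ← mul_assoc r, hrr]
    simp only [star_mul, star_star, mul_assoc]

end FunctionalCalculus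

/-! ### Isometries on `ℓ²(ℕ)` with orthogonal ranges, and stable algebras -/

section Stable

/-- The isometric embedding `ℂ → ℓ²(ℕ)`, `c ↦ c δ_n`. -/
noncomputable def ellSingle (n : ℕ) : ℂ →ₗᵢ[ℂ] lp (fun _ : ℕ => ℂ) 2 where
  toFun c := lp.single 2 n c
  map_add' c d := lp.single_add (E := fun _ : ℕ => ℂ) 2 n c d
  map_smul' a c := lp.single_smul (E := fun _ : ℕ => ℂ) 2 n a c
  norm_map' c := by
    have h : (0 : ℝ≥0∞) < 2 := two_pos
    exact lp.norm_single (E := fun _ : ℕ => ℂ) h n c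

theorem inner_ellSingle {m n : ℕ} (h : m ≠ n) (c d : ℂ) :
    inner ℂ (ellSingle m c) (ellSingle n d) = 0 := by
  change inner ℂ (lp.single 2 m c : lp (fun _ : ℕ => ℂ) 2) (lp.single 2 n d) = 0
  rw [lp.inner_single_left, lp.single_apply_ne _ _ _ h, inner_zero_right]

theorem orthogonalFamily_pair (k : ℕ) :
    OrthogonalFamily ℂ (fun _ : ℕ => ℂ) (fun m : ℕ => ellSingle (Nat.pair k m)) := by
  intro v w hvw c d
  exact inner_ellSingle (fun h => hvw (Nat.pair_eq_pair.1 h).2) c d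

/-- The isometry `δ_m ↦ δ_{⟨k, m⟩}` of `ℓ²(ℕ)`, where `⟨k, m⟩` is the pairing of the two natural
numbers. -/
noncomputable def pairIsometry (k : ℕ) :
    lp (fun _ : ℕ => ℂ) 2 →L[ℂ] lp (fun _ : ℕ => ℂ) 2 :=
  (orthogonalFamily_pair k).linearIsometry.toContinuousLinearMap

theorem star_pairIsometry_mul (k l : ℕ) :
    star (pairIsometry k) * pairIsometry l = if k = l then 1 else 0 := by
  refine ContinuousLinearMap.ext fun y => ext_inner_left ℂ fun x => ?_
  rw [mul_apply_eq_comp, ContinuousLinearMap.star_eq_adjoint,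
    ContinuousLinearMap.adjoint_inner_right]
  split_ifs with h
  · subst h
    exact (orthogonalFamily_pair k).linearIsometry.inner_map_map x y
  · have hx := (orthogonalFamily_pair k).hasSum_linearIsometry x
    have hy := (orthogonalFamily_pair l).hasSum_linearIsometry y
    have h1 : ∀ m, inner ℂ (ellSingle (Nat.pair k m) (x m)) (pairIsometry l y) = 0 := fun m => by
      refine (hy.mapL (innerSL ℂ (ellSingle (Nat.pair k m) (x m)))).unique ?_
      refine hasSum_zero.congr_fun fun n => ?_
      exact inner_ellSingle (fun h' => h (Nat.pair_eq_pair.1 h').1) _ _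
    have h2 := hx.mapL (innerSL ℂ (pairIsometry l y))
    have h3 : inner ℂ (pairIsometry l y) (pairIsometry k x) = 0 := by
      refine h2.unique (hasSum_zero.congr_fun fun n => ?_)
      rw [innerSL_apply_apply, ← inner_conj_symm]
      exact (congrArg _ (h1 n)).trans (map_zero _)
    rw [zero_apply, inner_zero_right, ← inner_conj_symm, h3, map_zero]

/-- Left multiplication by `pairIsometry k` on the compact operators. -/
noncomputable def compactShift (k : ℕ) : K →ₗ[ℂ] K where
  toFun T := ⟨pairIsometry k * T.1, T.2.clm_comp (pairIsometry k)⟩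
  map_add' _ _ := Subtype.ext (mul_add _ _ _)
  map_smul' _ _ := Subtype.ext (mul_smul_comm _ _ _)

theorem star_compactShift_mul (k l : ℕ) (S T : K) :
    star (compactShift k S) * compactShift l T = if k = l then star S * T else 0 := by
  refine Subtype.ext ?_
  change star (pairIsometry k * S.1) * (pairIsometry l * T.1) = _
  rw [star_mul, mul_assoc, ← mul_assoc (star (pairIsometry k)), star_pairIsometry_mul]
  split_ifs
  · rw [one_mul]; rfl
  · rw [zero_mul, mul_zero]; rfl

theorem star_lTensor_mul {D E : Type*} [NonUnitalCStarAlgebra D] [NonUnitalCStarAlgebra E]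
    (s : ℕ → E →ₗ[ℂ] E)
    (hs : ∀ k l S T, star (s k S) * s l T = if k = l then star S * T else 0) (k l : ℕ)
    (X Y : D ⊗[ℂ] E) :
    star ((s k).lTensor D X) * (s l).lTensor D Y = if k = l then star X * Y else 0 := by
  induction X with
  | zero => simp
  | add X X' hX hX' =>
    rw [map_add, star_add, add_mul, hX, hX', star_add, add_mul]
    split_ifs <;> simp
  | tmul d S =>
    induction Y with
    | zero => simp
    | add Y Y' hY hY' =>
      rw [map_add, mul_add, hY, hY', mul_add]
      split_ifs <;> simp
    | tmul e T =>
      simp only [LinearMap.lTensor_tmul, TensorProduct.star_tmul,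
        Algebra.TensorProduct.tmul_mul_tmul, hs]
      split_ifs <;> simp

/-- The shifts are the images of `id ⊗ s k`. -/
theorem exists_shift_of_tensorProduct {D E : Type*} [NonUnitalCStarAlgebra D]
    [NonUnitalCStarAlgebra E] (s : ℕ → E →ₗ[ℂ] E)
    (hs : ∀ k l S T, star (s k S) * s l T = if k = l then star S * T else 0)
    (h : IsCStarTensorProduct D E D) :
    ∃ (D₀ : Set D) (σ : ℕ → D → D), Dense D₀ ∧ ∀ k l, ∀ d ∈ D₀, ∀ e ∈ D₀,
      star (σ k d) * σ l e = if k = l then star d * e else 0 := by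
  obtain ⟨φ, -, hφ⟩ := h
  have hinv : ∀ d ∈ Set.range φ, φ (Function.invFun φ d) = d := fun d hd =>
    Function.invFun_eq hd
  refine ⟨Set.range φ, fun k d => φ ((s k).lTensor D (Function.invFun φ d)), hφ,
    fun k l d hd e he => ?_⟩
  rw [← map_star, ← map_mul, star_lTensor_mul s hs]
  split_ifs
  · rw [map_mul, map_star, hinv d hd, hinv e he]
  · exact map_zero φ

/-- A stable algebra has a dense set `D₀` with shifts `σ₀, σ₁, …` that behave like multiplication
with isometries with pairwise orthogonal ranges. -/
theorem IsStable.exists_shift {D : Type*} [NonUnitalCStarAlgebra D] (hD : IsStable D) :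
    ∃ (D₀ : Set D) (σ : ℕ → D → D), Dense D₀ ∧ ∀ k l, ∀ d ∈ D₀, ∀ e ∈ D₀,
      star (σ k d) * σ l e = if k = l then star d * e else 0 :=
  exists_shift_of_tensorProduct compactShift star_compactShift_mul hD

end Stable

/-! ### Purely large extensions -/

section Full

variable {J : Type*} [NonUnitalCStarAlgebra J]

/-- If `D` is full in `J`, then the sums of the elements `(d u)⋆ (e v)`, with `d`, `e` in a dense
subset of `D` and `u`, `v` in `J`, are dense in `J`: their closure is an ideal that contains `D`. -/
theorem dense_closure_of_full (D : NonUnitalStarSubalgebra ℂ J) [IsClosed (D : Set J)]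
    (hfull : closedIdeal (D : Set J) = ⊤) (hD : IsSigmaUnital D) {D₀ : Set D} (hD₀ : Dense D₀) :
    Dense (AddSubmonoid.closure
      {t : J | ∃ d ∈ D₀, ∃ e ∈ D₀, ∃ u v : J, t = star ((d : J) * u) * ((e : J) * v)} : Set J) := by
  set S := {t : J | ∃ d ∈ D₀, ∃ e ∈ D₀, ∃ u v : J, t = star ((d : J) * u) * ((e : J) * v)} with hS
  set Q := AddSubmonoid.closure S with hQ
  have hneg : ∀ x ∈ Q, -x ∈ Q := fun x hx => by
    induction hx using AddSubmonoid.closure_induction with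
    | mem x hx =>
      obtain ⟨d, hd, e, he, u, v, rfl⟩ := hx
      exact AddSubmonoid.subset_closure ⟨d, hd, e, he, u, -v, by simp⟩
    | zero => simp
    | add x y _ _ hx hy => rw [neg_add]; exact add_mem hx hy
  have hleft : ∀ z, ∀ x ∈ Q, z * x ∈ Q := fun z x hx => by
    induction hx using AddSubmonoid.closure_induction with
    | mem x hx =>
      obtain ⟨d, hd, e, he, u, v, rfl⟩ := hx
      exact AddSubmonoid.subset_closure ⟨d, hd, e, he, u * star z, v, by simp [mul_assoc]⟩
    | zero => simp
    | add x y _ _ hx hy => rw [mul_add]; exact add_mem hx hy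
  have hright : ∀ z, ∀ x ∈ Q, x * z ∈ Q := fun z x hx => by
    induction hx using AddSubmonoid.closure_induction with
    | mem x hx =>
      obtain ⟨d, hd, e, he, u, v, rfl⟩ := hx
      exact AddSubmonoid.subset_closure ⟨d, hd, e, he, u, v * z, by simp [mul_assoc]⟩
    | zero => simp
    | add x y _ _ hx hy => rw [add_mul]; exact add_mem hx hy
  let I : TwoSidedIdeal J := TwoSidedIdeal.mk' (closure (Q : Set J))
    (subset_closure Q.zero_mem) (fun hx hy => Q.topologicalClosure.add_mem hx hy)
    (fun {x} hx => map_mem_closure continuous_neg hx hneg)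
    (fun {x y} hy => map_mem_closure (continuous_const_mul x) hy (hleft x))
    (fun {x y} hx => map_mem_closure (f := fun z => z * y) (continuous_mul_const y) hx (hright y))
  have hI : ∀ x, x ∈ I ↔ x ∈ closure (Q : Set J) := fun x => TwoSidedIdeal.mem_mk' ..
  have hIcoe : (I : Set J) = closure (Q : Set J) := Set.ext hI
  have hIcl : IsClosed (I : Set J) := hIcoe ▸ isClosed_closure
  have hprod : ∀ (d e : D) (u v : J), star ((d : J) * u) * ((e : J) * v) ∈ I := by
    intro d e u v
    have hc : IsClosed {p : D × D | star ((p.1 : J) * u) * ((p.2 : J) * v) ∈ (I : Set J)} :=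
      hIcl.preimage (by fun_prop)
    have hsub : D₀ ×ˢ D₀ ⊆ {p : D × D | star ((p.1 : J) * u) * ((p.2 : J) * v) ∈ (I : Set J)} :=
      fun p hp => (hI _).2 (subset_closure (AddSubmonoid.subset_closure
        ⟨p.1, hp.1, p.2, hp.2, u, v, rfl⟩))
    have := closure_minimal hsub hc
    rw [(hD₀.prod hD₀).closure_eq] at this
    exact this (Set.mem_univ (d, e))
  obtain ⟨w, -, -, hwl, hwr⟩ := hD
  have hwl' : ∀ d : D, Tendsto (fun n => (w n : J) * d) atTop (𝓝 (d : J)) := fun d =>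
    (continuous_subtype_val.tendsto d).comp (hwl d)
  have hwr' : ∀ d : D, Tendsto (fun n => (d : J) * w n) atTop (𝓝 (d : J)) := fun d =>
    (continuous_subtype_val.tendsto d).comp (hwr d)
  have h3 : ∀ d e u : D, star ((d : J) * u) * (e : J) ∈ I := fun d e u =>
    hIcl.mem_of_tendsto ((hwr' e).const_mul _) (Eventually.of_forall fun n => hprod d e u (w n))
  have h2 : ∀ d e : D, (d : J) * e ∈ I := fun d e => by
    refine hIcl.mem_of_tendsto ((hwl' e).const_mul (d : J)) (Eventually.of_forall fun n => ?_)
    have := h3 (star (w n)) e (star d)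
    simpa [mul_assoc] using this
  have h1 : ∀ e : D, (e : J) ∈ I := fun e =>
    hIcl.mem_of_tendsto (hwl' e) (Eventually.of_forall fun n => h2 (w n) e)
  have htop : closedIdeal (D : Set J) ≤ I := sInf_le ⟨hIcl, fun x hx => h1 ⟨x, hx⟩⟩
  intro x
  rw [← hI]
  rw [hfull] at htop
  exact htop trivial

/-- By means of the shifts `σ k`, a sum of the elements `(d u)⋆ (e v)` becomes a single product
`c⋆ e`, where `c` is a sum of the elements `σ k d * u`. -/
theorem exists_star_mul_eq {D : NonUnitalStarSubalgebra ℂ J} [IsClosed (D : Set J)] {D₀ : Set D}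
    {σ : ℕ → D → D}
    (hσ : ∀ k l, ∀ d ∈ D₀, ∀ e ∈ D₀, star (σ k d) * σ l e = if k = l then star d * e else 0)
    (R : AddSubmonoid J) (hR : ∀ k d (u : J), (σ k d : J) * u ∈ R) {t : J}
    (ht : t ∈ AddSubmonoid.closure
      {t : J | ∃ d ∈ D₀, ∃ e ∈ D₀, ∃ u v : J, t = star ((d : J) * u) * ((e : J) * v)}) :
    ∃ c ∈ R, ∃ e, star c * e = t := by
  have hσ' : ∀ k l, ∀ d ∈ D₀, ∀ e ∈ D₀,
      star (σ k d : J) * (σ l e : J) = if k = l then star (d : J) * e else 0 := by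
    intro k l d hd e he
    have := congrArg (Subtype.val : D → J) (hσ k l d hd e he)
    split_ifs at this ⊢ <;> exact this
  -- the shifts `σ k` with `k < m` are kept free for the summands still to come
  suffices h : ∀ m : ℕ, ∃ c ∈ R, ∃ e, star c * e = t ∧
      ∀ k < m, ∀ d ∈ D₀, star (σ k d : J) * c = 0 ∧ star (σ k d : J) * e = 0 by
    obtain ⟨c, hc, e, he, -⟩ := h 0
    exact ⟨c, hc, e, he⟩
  induction ht using AddSubmonoid.closure_induction_left with
  | zero => exact fun m => ⟨0, R.zero_mem, 0, by simp, by simp⟩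
  | add_left x hx y _ ih =>
    intro m
    obtain ⟨d, hd, e, he, u, v, rfl⟩ := hx
    obtain ⟨c', hc', e', rfl, h⟩ := ih (m + 1)
    have hc0 : star c' * (σ m e : J) = 0 := by
      have := congrArg star (h m m.lt_succ_self e he).1
      simpa using this
    refine ⟨σ m d * u + c', add_mem (hR _ _ _) hc', σ m e * v + e', ?_, fun k hk b hb => ⟨?_, ?_⟩⟩
    · have h1 : star ((σ m d : J) * u) * ((σ m e : J) * v) = star ((d : J) * u) * (e * v) := by
        rw [star_mul, mul_assoc, ← mul_assoc (star (σ m d : J)), hσ' m m d hd e he, if_pos rfl,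
          star_mul]
        simp only [mul_assoc]
      have h2 : star ((σ m d : J) * u) * e' = 0 := by
        rw [star_mul, mul_assoc, (h m m.lt_succ_self d hd).2, mul_zero]
      rw [star_add, add_mul, mul_add, mul_add, h1, h2, ← mul_assoc (star c'), hc0]
      simp
    · rw [mul_add, ← mul_assoc, hσ' k m b hb d hd, if_neg hk.ne, zero_mul, zero_add]
      exact (h k (hk.trans m.lt_succ_self) b hb).1
    · rw [mul_add, ← mul_assoc, hσ' k m b hb e he, if_neg hk.ne, zero_mul, zero_add]
      exact (h k (hk.trans m.lt_succ_self) b hb).2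

end Full

/-- In a purely large extension every `s⋆s` with `s ∈ J` is a limit of elements `f⋆f` such that `f`
has all the left units of a given `a ∉ J`. As `‖f‖ ^ 2 = ‖f⋆f‖`, this comes with a bound on the norm
of `f` which does not depend on the extension. -/
theorem Extension.IsPurelyLarge.exists_approx {J A B : Type*} [NonUnitalCStarAlgebra J]
    [NonUnitalCStarAlgebra A] [NonUnitalCStarAlgebra B] {E : Extension J A B}
    (hE : E.IsPurelyLarge) {a g : A} (ha : E.π a ≠ 0) (hg : g * a = a) (s : J) {ε : ℝ}
    (hε : 0 < ε) :
    ∃ f : J, g * E.ι f = E.ι f ∧ ‖star f * f - star s * s‖ < ε := by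
  obtain ⟨D, hDc, hDa, hDst, hDσ, hfull⟩ := hE a fun h => ha ((E.exact a).2 h)
  obtain ⟨D₀, σ, hD₀, hσ⟩ := hDst.exists_shift
  have hgD : ∀ d ∈ D, g * E.ι d = E.ι d := fun d hd => by
    have hcl : IsClosed {x : A | g * x = x} := isClosed_eq (by fun_prop) continuous_id
    refine closure_minimal ?_ hcl (hDa d hd)
    rintro _ ⟨j, rfl⟩
    change g * (a * E.ι j * star a) = a * E.ι j * star a
    rw [← mul_assoc, ← mul_assoc, hg]
  let R : AddSubmonoid J :=
    { carrier := {c | g * E.ι c = E.ι c}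
      zero_mem' := by simp
      add_mem' := fun {x y} hx hy => by
        change g * E.ι (x + y) = E.ι (x + y)
        rw [map_add, mul_add, hx, hy] }
  have hR : ∀ k d (u : J), (σ k d : J) * u ∈ R := fun k d u => by
    change g * E.ι (σ k d * u) = E.ι (σ k d * u)
    rw [map_mul, ← mul_assoc, hgD _ (σ k d).2]
  have hopen : IsOpen {t : J | ‖star t * t - star s * s‖ < ε} :=
    isOpen_lt (by fun_prop) continuous_const
  obtain ⟨t, htQ, htε⟩ := (dense_closure_of_full D hfull hDσ hD₀).exists_mem_open hopen
    ⟨s, by simpa using hε⟩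
  obtain ⟨c, hc, e, rfl⟩ := exists_star_mul_eq hσ R hR htQ
  obtain ⟨f, hf, hff⟩ := exists_star_mul_self_eq E.ι c e hc
  exact ⟨f, hf, hff ▸ htε⟩

/-! ### Ultraproducts of extensions -/

section UltraproductExtension

universe u v w

variable (ω : Ultrafilter ℕ)

/-- A norm-bounded sequence, as an element of the product. -/
def boundedSeq {A : ℕ → Type u} [∀ i, NonUnitalCStarAlgebra (A i)] (a : ∀ i, A i) (c : ℝ)
    (h : ∀ i, ‖a i‖ ≤ c) : lp A ∞ :=
  ⟨a, memℓp_infty ⟨c, by rintro _ ⟨i, rfl⟩; exact h i⟩⟩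

theorem Ultraproduct.mk_eq_mk_of_eventuallyEq {A : ℕ → Type u} [∀ i, NonUnitalCStarAlgebra (A i)]
    {a b : lp A ∞} (h : ∀ᶠ i in (ω : Filter ℕ), a i = b i) : mk ω a = mk ω b := by
  rw [mk_eq_mk, mem_nullSequences]
  refine tendsto_const_nhds.congr' (h.mono fun i hi => ?_)
  change (0 : ℝ) = ‖a i - b i‖
  rw [hi, sub_self, norm_zero]

variable {J : ℕ → Type u} {A : ℕ → Type v} {B : ℕ → Type w}
  [∀ i, NonUnitalCStarAlgebra (J i)] [∀ i, NonUnitalCStarAlgebra (A i)]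
  [∀ i, NonUnitalCStarAlgebra (B i)]

theorem Ultraproduct.map_surjective (φ : ∀ i, A i →⋆ₙₐ[ℂ] B i)
    (hφ : ∀ i, Function.Surjective (φ i)) : Function.Surjective (map ω φ) := by
  intro z
  obtain ⟨b, rfl⟩ := mk_surjective ω z
  choose a ha hn using fun i => exists_lift_norm_le (φ i) (hφ i) (b i)
  refine ⟨mk ω (boundedSeq a ‖b‖ fun i =>
    (hn i).trans (lp.norm_apply_le_norm ENNReal.top_ne_zero b i)), ?_⟩
  rw [map_mk]
  exact mk_eq_mk_of_eventuallyEq ω (Eventually.of_forall ha)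

/-- The ultraproduct of exact sequences is exact in the middle. -/
theorem Ultraproduct.exists_map_eq (E : ∀ i, Extension (J i) (A i) (B i)) (z : Ultraproduct ω A)
    (hz : map ω (fun i => (E i).π) z = 0) : ∃ s, map ω (fun i => (E i).ι) s = z := by
  obtain ⟨a, rfl⟩ := mk_surjective ω z
  rw [map_mk, ← map_zero (mk ω), mk_eq_mk, sub_zero, mem_nullSequences] at hz
  choose a' ha' hn using fun i => exists_lift_norm_le (E i).π (E i).surjective ((E i).π (a i))
  have hker : ∀ i, ∃ j, (E i).ι j = a i - a' i := fun i =>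
    ((E i).exact _).1 (by rw [map_sub, ha', sub_self])
  choose j hj using hker
  have hbd : ∀ i, ‖j i‖ ≤ ‖a‖ + ‖a‖ := fun i => by
    have h1 : ‖a i‖ ≤ ‖a‖ := lp.norm_apply_le_norm ENNReal.top_ne_zero a i
    rw [← NonUnitalStarAlgHom.norm_map (E i).ι (E i).injective, hj]
    exact (norm_sub_le _ _).trans (add_le_add h1
      ((hn i).trans ((NonUnitalStarAlgHom.norm_apply_le (E i).π (a i)).trans h1)))
  refine ⟨mk ω (boundedSeq j _ hbd), ?_⟩
  rw [map_mk, mk_eq_mk, mem_nullSequences]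
  refine squeeze_zero (fun _ => norm_nonneg _) (fun i => ?_) hz
  change ‖(E i).ι (j i) - a i‖ ≤ ‖(E i).π (a i)‖
  rw [hj, sub_sub_cancel_left, norm_neg]
  exact hn i

theorem isClosed_closedIdeal {A : Type*} [NonUnitalCStarAlgebra A] (S : Set A) :
    IsClosed (closedIdeal S : Set A) := by
  have : (closedIdeal S : Set A) =
      ⋂ I ∈ {I : TwoSidedIdeal A | IsClosed (I : Set A) ∧ S ⊆ (I : Set A)}, (I : Set A) := by
    ext x
    simp only [Set.mem_iInter]
    exact TwoSidedIdeal.mem_sInf A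
  rw [this]
  exact isClosed_biInter fun I hI => hI.1

theorem subset_closedIdeal {A : Type*} [NonUnitalCStarAlgebra A] (S : Set A) :
    S ⊆ (closedIdeal S : Set A) := fun _ hx =>
  (TwoSidedIdeal.mem_sInf A).2 fun _ hI => hI.2 hx

/-- An element `y` that does not vanish modulo the ideal generates every `s⋆s` with `s` in the
ideal: coordinatewise, `s⋆s ≈ f⋆f = f⋆ h y⋆y f`, with `f` and `h` bounded uniformly. -/
theorem smul_map_star_mul_self_mem (hω : (ω : Filter ℕ) ≤ cofinite)
    (E : ∀ i, Extension (J i) (A i) (B i)) (hE : ∀ i, (E i).IsPurelyLarge) (y : Ultraproduct ω A)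
    (hy : Ultraproduct.map ω (fun i => (E i).π) y ≠ 0) (s : Ultraproduct ω J) (z : ℂ) :
    z • Ultraproduct.map ω (fun i => (E i).ι) (star s * s) ∈ closedIdeal {y} := by
  obtain ⟨b, rfl⟩ := Ultraproduct.mk_surjective ω y
  obtain ⟨r, rfl⟩ := Ultraproduct.mk_surjective ω s
  obtain ⟨κ, hκ, hκb⟩ : ∃ κ : ℝ, 0 < κ ∧ ∀ᶠ i in (ω : Filter ℕ), κ < ‖(E i).π (b i)‖ ^ 2 := by
    by_contra! hcon
    apply hy
    rw [Ultraproduct.map_mk, ← map_zero (Ultraproduct.mk ω), Ultraproduct.mk_eq_mk, sub_zero,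
      Ultraproduct.mem_nullSequences, Metric.tendsto_nhds]
    intro ε hε
    filter_upwards [hcon ((ε / 2) ^ 2) (by positivity)] with i hi
    rw [dist_zero_right, norm_norm]
    change ‖(E i).π (b i)‖ < ε
    have := abs_le_of_sq_le_sq hi (by positivity)
    linarith [le_abs_self ‖(E i).π (b i)‖]
  have key : ∀ i, ∃ (f : J i) (h : A i), ‖h‖ ≤ κ⁻¹ ∧ ‖f‖ ≤ ‖r‖ + 1 ∧
      (κ < ‖(E i).π (b i)‖ ^ 2 → ‖star f * f - star (r i) * r i‖ ≤ 1 / ((i : ℝ) + 1) ∧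
        h * (star (b i) * b i) * (E i).ι f = (E i).ι f) := by
    intro i
    by_cases hi : κ < ‖(E i).π (b i)‖ ^ 2
    · obtain ⟨a, h, ha, hh, hha⟩ := exists_cutoff (E i).π hκ (b i) hi
      obtain ⟨f, hf, hfr⟩ := (hE i).exists_approx ha hha (r i)
        (ε := 1 / ((i : ℝ) + 1)) (by positivity)
      refine ⟨f, h, hh, ?_, fun _ => ⟨hfr.le, hf⟩⟩
      have h1 : ‖r i‖ ≤ ‖r‖ := lp.norm_apply_le_norm ENNReal.top_ne_zero r i
      have h2 : 1 / ((i : ℝ) + 1) ≤ 1 := by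
        rw [div_le_one (by positivity)]; linarith [(i.cast_nonneg : (0 : ℝ) ≤ i)]
      have h3 := norm_le_norm_add_norm_sub' (star f * f) (star (r i) * r i)
      rw [CStarRing.norm_star_mul_self, CStarRing.norm_star_mul_self] at h3
      nlinarith [norm_nonneg (r i), norm_nonneg f]
    · exact ⟨0, 0, by simpa using hκ.le, by rw [norm_zero]; positivity, fun h => absurd h hi⟩
  choose f h hh hf hfh using key
  set F := Ultraproduct.mk ω (boundedSeq f _ hf) with hF
  set H := Ultraproduct.mk ω (boundedSeq h _ hh) with hH
  have h1 : star (Ultraproduct.mk ω r) * Ultraproduct.mk ω r = star F * F := by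
    rw [hF, ← Ultraproduct.mk_star, ← Ultraproduct.mk_star, ← Ultraproduct.mk_mul,
      ← Ultraproduct.mk_mul, eq_comm, Ultraproduct.mk_eq_mk, Ultraproduct.mem_nullSequences]
    have hlim : Tendsto (fun i : ℕ => 1 / ((i : ℝ) + 1)) ω (𝓝 0) :=
      tendsto_one_div_add_atTop_nhds_zero_nat.mono_left (hω.trans Nat.cofinite_eq_atTop.le)
    refine tendsto_of_tendsto_of_tendsto_of_le_of_le' tendsto_const_nhds hlim
      (Eventually.of_forall fun _ => norm_nonneg _) (hκb.mono fun i hi => ?_)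
    exact (hfh i hi).1
  have h2 : H * (star (Ultraproduct.mk ω b) * Ultraproduct.mk ω b) *
      Ultraproduct.map ω (fun i => (E i).ι) F = Ultraproduct.map ω (fun i => (E i).ι) F := by
    rw [hF, hH, Ultraproduct.map_mk, ← Ultraproduct.mk_star, ← Ultraproduct.mk_mul,
      ← Ultraproduct.mk_mul, ← Ultraproduct.mk_mul]
    exact Ultraproduct.mk_eq_mk_of_eventuallyEq ω (hκb.mono fun i hi => (hfh i hi).2)
  rw [h1, map_mul, ← h2, ← smul_mul_assoc]
  refine TwoSidedIdeal.mul_mem_left _ _ _ (TwoSidedIdeal.mul_mem_right _ _ _ ?_)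
  exact TwoSidedIdeal.mul_mem_left _ _ _ (TwoSidedIdeal.mul_mem_left _ _ _
    (subset_closedIdeal _ rfl))

/-- An element that does not vanish modulo the ideal generates the whole ideal. -/
theorem map_mem_closedIdeal (hω : (ω : Filter ℕ) ≤ cofinite)
    (E : ∀ i, Extension (J i) (A i) (B i)) (hE : ∀ i, (E i).IsPurelyLarge) (y : Ultraproduct ω A)
    (hy : Ultraproduct.map ω (fun i => (E i).π) y ≠ 0) (s : Ultraproduct ω J) :
    Ultraproduct.map ω (fun i => (E i).ι) s ∈ closedIdeal {y} := by
  let _ := CStarAlgebra.spectralOrder (Ultraproduct ω J)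
  have _ := CStarAlgebra.spectralOrderedRing (Ultraproduct ω J)
  have hs : s ∈ Submodule.span ℂ {a : Ultraproduct ω J | 0 ≤ a} := by
    rw [CStarAlgebra.span_nonneg]; trivial
  suffices h : ∀ z : ℂ, z • Ultraproduct.map ω (fun i => (E i).ι) s ∈ closedIdeal {y} by
    simpa using h 1
  induction hs using Submodule.span_induction with
  | mem x hx =>
    change 0 ≤ x at hx
    obtain ⟨p, rfl⟩ := CStarAlgebra.nonneg_iff_eq_star_mul_self.1 hx
    exact smul_map_star_mul_self_mem ω hω E hE y hy p
  | zero => intro z; rw [map_zero, smul_zero]; exact zero_mem _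
  | add x x' _ _ hx hx' => intro z; rw [map_add, smul_add]; exact add_mem (hx z) (hx' z)
  | smul c x _ hx => intro z; rw [map_smul, smul_smul]; exact hx _

/-- A surjective ⋆-homomorphism maps a closed ideal that contains the kernel onto a closed ideal. -/
theorem mem_closedIdeal_of_map_mem {A B : Type*} [NonUnitalCStarAlgebra A]
    [NonUnitalCStarAlgebra B] (φ : A →⋆ₙₐ[ℂ] B) (hφ : Function.Surjective φ) {x y : A}
    (hker : ∀ z, φ z = 0 → z ∈ closedIdeal {y}) (hx : φ x ∈ closedIdeal {φ y}) :
    x ∈ closedIdeal {y} := by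
  let L : A →L[ℂ] B := LinearMap.mkContinuous
    { toFun := φ, map_add' := map_add φ, map_smul' := map_smul φ } 1
    fun a => by rw [one_mul]; exact NonUnitalStarAlgHom.norm_apply_le φ a
  have hquot : IsQuotientMap φ := (L.isOpenMap hφ).isQuotientMap L.continuous hφ
  have hmem : ∀ z w, φ z = φ w → w ∈ closedIdeal {y} → z ∈ closedIdeal {y} := fun z w h hw => by
    have := add_mem (hker (z - w) (by rw [map_sub, h, sub_self])) hw
    rwa [sub_add_cancel] at this
  let I : TwoSidedIdeal B := TwoSidedIdeal.mk' (φ '' (closedIdeal {y} : Set A))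
    ⟨0, zero_mem _, map_zero φ⟩
    (by rintro _ _ ⟨a, ha, rfl⟩ ⟨b, hb, rfl⟩; exact ⟨a + b, add_mem ha hb, map_add φ a b⟩)
    (by rintro _ ⟨a, ha, rfl⟩; exact ⟨-a, neg_mem ha, map_neg φ a⟩)
    (by
      rintro c _ ⟨a, ha, rfl⟩
      obtain ⟨c, rfl⟩ := hφ c
      exact ⟨c * a, TwoSidedIdeal.mul_mem_left _ _ _ ha, map_mul φ c a⟩)
    (by
      rintro _ c ⟨a, ha, rfl⟩
      obtain ⟨c, rfl⟩ := hφ c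
      exact ⟨a * c, TwoSidedIdeal.mul_mem_right _ _ _ ha, map_mul φ a c⟩)
  have hI : (I : Set B) = φ '' (closedIdeal {y} : Set A) := TwoSidedIdeal.coe_mk' ..
  have hpre : φ ⁻¹' (I : Set B) = (closedIdeal {y} : Set A) := by
    rw [hI]
    refine Set.Subset.antisymm ?_ (Set.subset_preimage_image _ _)
    rintro z ⟨w, hw, hwz⟩
    exact hmem z w hwz.symm hw
  have hclosed : IsClosed (I : Set B) := by
    rw [← hquot.isClosed_preimage, hpre]
    exact isClosed_closedIdeal _
  have hle : closedIdeal {φ y} ≤ I := sInf_le ⟨hclosed, by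
    rw [hI, Set.singleton_subset_iff]
    exact ⟨y, subset_closedIdeal _ rfl, rfl⟩⟩
  have hxI : x ∈ φ ⁻¹' (I : Set B) := hle hx
  rw [hpre] at hxI
  exact hxI

end UltraproductExtension
end PurelyLarge

open PurelyLarge in
theorem mainTheorem2 (ω : Ultrafilter ℕ) (hω : (ω : Filter ℕ) ≤ Filter.cofinite)
    {J : ℕ → Type*} {A : ℕ → Type*} {B : ℕ → Type*}
    [∀ i, NonUnitalCStarAlgebra (J i)] [∀ i, NonUnitalCStarAlgebra (A i)]
    [∀ i, NonUnitalCStarAlgebra (B i)]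
    (E : ∀ i, Extension (J i) (A i) (B i))
    (hE : ∀ i, (E i).IsPurelyLarge)
    (hB : ∀ i, IsCuntzInfinityStable (B i))
    (x y : Ultraproduct ω A)
    (hy : Ultraproduct.map ω (fun i => (E i).π) y ≠ 0)
    (hxy : Ultraproduct.map ω (fun i => (E i).π) x ∈
      closedIdeal {Ultraproduct.map ω (fun i => (E i).π) y}) :
    x ∈ closedIdeal {y} := by
  refine mem_closedIdeal_of_map_mem _
    (Ultraproduct.map_surjective ω _ fun i => (E i).surjective) (fun z hz => ?_) hxy
  obtain ⟨s, rfl⟩ := Ultraproduct.exists_map_eq ω E z hz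
  exact map_mem_closedIdeal ω hω E hE y hy s
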